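/- Let $d>1$ be a fixed real number, let $\alpha>2$ and $\beta\ge 23$ be real, let $q$ be a fixed integer with $q\ge\alpha d+\beta$, and let $t(n)$ be an arbitrary function with $t(n)\to\infty$ as $n\to\infty$. Let $v\in V$ be fixed arbitrarily, and let $G=(V,E)$ be drawn from the Erdős–Rényi random graph $G(n,d/n)$ on the $n$-element vertex set $V$. Then, with probability $1-o(1)$ as $n\to\infty$, the following holds: for every real $t$ with $t(n)\le t\le\frac{\ln n}{\ln d}$ and every vertex set $\Delta\subset V$ with $\mathrm{dist}_G(v,\Delta)>2t$, there is a permissive cutset $S$ in the tree $T=T_{\mathrm{SAW}}(G,v)$ for $v$ and $\Delta$ such that $t\le\mathrm{dist}_T(v,x)<2t$ for all $x\in S$. Here $\mathrm{dist}_G(u,\Delta)$ is the minimum over $w\in\Delta$ of the graph distance from $u$ to $w$ (it is $\infty$ if no vertex of $\Delta$ is reachable from $u$). The vertices of the self-avoiding walk tree $T_{\mathrm{SAW}}(G,v)$ are the self-avoiding walks in $G$ starting at $v$; the root is the trivial walk, again denoted $v$, and each walk $p$ is the parent of the self-avoiding walks $(p,u)$ that extend it by one vertex $u\in V$. Each vertex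 of $T$ is identified with the last vertex of its walk. A set $S$ of vertices of $T$ is a cutset in $T$ for $v$ and $\Delta$ if (1) no element of $S$ is identified with $v$ or with a vertex $u$ satisfying $\mathrm{dist}_G(u,\Delta)<2$, and (2) every self-avoiding walk from $v$ to a vertex of $\Delta$ has an initial segment (possibly the whole walk) belonging to $S$. The cutset is permissive if each of its elements is identified with a vertex $w$ of $G$ such that $q>d_G(u)+1$ for $u=w$ and for every neighbor $u$ of $w$ in $G$, where $d_G(u)$ is the degree of $u$ in $G$. -/

import Mathlib

namespace SimpleGraph

/-- The distance from a vertex `u` to a set `A` of vertices: the least distance from `u` to a vertex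
of `A`. It is `⊤` if no vertex of `A` can be reached from `u` (in particular if `A` is empty). -/
noncomputable def distToSet {V : Type*} (G : SimpleGraph V) (u : V) (A : Set V) : ℕ∞ :=
  ⨅ w ∈ A, G.edist u w

open Classical in
/-- In the list-coloring instance `(G, L)` with colors from `Fin q`, the vertex `v` is *permissive*
if `|L(u)| > d_G(u) + 1` for `u = v` and for all neighbors `u` of `v`. -/
def IsPermissive {V : Type*} [Fintype V] (G : SimpleGraph V) {q : ℕ} (L : V → Finset (Fin q))
    (v : V) : Prop :=
  ∀ u : V, u = v ∨ G.Adj v u → G.degree u + 1 < (L u).card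

/-- A self-avoiding walk of `G` that starts at `v` and ends at the vertex `last`. -/
structure SAW {V : Type*} (G : SimpleGraph V) (v : V) where
  last : V
  walk : G.Walk v last
  isPath : walk.IsPath

namespace SAW

/-- The trivial walk at `v`, the root of the self-avoiding walk tree. -/
def root {V : Type*} (G : SimpleGraph V) (v : V) : SAW G v :=
  ⟨v, Walk.nil, Walk.IsPath.nil⟩

/-- `y` is `x` followed by one more vertex, i.e. `x` is the parent of `y` in the tree. -/
def IsParent {V : Type*} {G : SimpleGraph V} {v : V} (x y : SAW G v) : Prop :=
  ∃ h : G.Adj x.last y.last, y.walk = x.walk.concat h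

/-- `x` is an initial segment of `y`, i.e. `x` lies on the path of the tree from the root to `y`
(both ends included). -/
def IsInitialSegment {V : Type*} {G : SimpleGraph V} {v : V} (x y : SAW G v) : Prop :=
  ∃ r : G.Walk x.last y.last, y.walk = x.walk.append r

end SAW

/-- The self-avoiding walk tree of `G` rooted at `v`: its vertices are the self-avoiding walks from
`v`, and each walk is joined to the walks that extend it by one vertex. A vertex `x` of the tree is
identified with the vertex `x.last` of `G`. -/
def sawTree {V : Type*} (G : SimpleGraph V) (v : V) : SimpleGraph (SAW G v) :=
  SimpleGraph.fromRel SAW.IsParent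

/-- `S` is a *cutset* in the self-avoiding walk tree of `G` rooted at `v`, for `v` and `A`. -/
structure IsCutset {V : Type*} (G : SimpleGraph V) (v : V) (A : Set V) (S : Set (SAW G v)) :
    Prop where
  last_ne : ∀ x ∈ S, x.last ≠ v
  two_le_dist : ∀ x ∈ S, 2 ≤ G.distToSet x.last A
  separates : ∀ w : SAW G v, w.last ∈ A → ∃ x ∈ S, x.IsInitialSegment w

/-- `S` is a *permissive cutset*, for `v` and `A`, with respect to the list-coloring instance
`(G, L)`. -/
structure IsPermissiveCutset {V : Type*} [Fintype V] (G : SimpleGraph V) {q : ℕ}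
    (L : V → Finset (Fin q)) (v : V) (A : Set V) (S : Set (SAW G v)) : Prop
    extends G.IsCutset v A S where
  permissive : ∀ x ∈ S, G.IsPermissive L x.last

end SimpleGraph

/-- The edge probability `d / n` (replaced by `1` if it exceeds `1`). -/
noncomputable def edgeProb (d : ℝ) (n : ℕ) : unitInterval :=
  Set.projIcc 0 1 zero_le_one (d / n)

/-! Write `q = K + 1` and `⌈t⌉₊ = a + 2`. A vertex fails to be permissive exactly when it or a
neighbor has degree at least `K`. If each path of length `2a+1` from `v` has a permissive vertex
among its last `a` vertices, the permissive walks of length in `[t, 2t - 1)` form the cutset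
(`exists_isPermissiveCutset`). It remains to exclude bad paths, whose last `a` vertices are all
non-permissive; this event depends on `t` only through `a`, and not on `Δ`.

This is a first-moment bound. At most `n^(2a+1)` candidate paths, each present with probability
`p^(2a+1)`, contribute `d^(2a+1)`, so badness must cost enough per vertex. For a fixed path let `J`
index its vertices of degree at least `K`. Each of them accounts for at most three indices; every
other bad vertex needs a further edge to a high-degree witness. By a Chernoff bound
(`binomialRandom_forall_degree_le`) each distinct high-degree vertex costs a factor `y = 9 e^(2d) /
3^K`, and summing over witnesses, coincidences included (`sum_pow_card_union_image_le`), costs at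
most `18 d y` per uncovered index. As `y ≤ γ^3` and `18 d y ≤ γ` for `γ = 1/(8d²)`, the total is at
most `γ^a`, up to a constant.

The `4^(a+1)` choices of `J` then give `12 d (4d²γ)^a = 12 d 2^(-a)`, whose tail over `a ≥ A` is
small; `t₀ → ∞` supplies `A`. The bound `t ≤ ln n / ln d` keeps `a` logarithmic, so the interaction
between the prescribed vertices is negligible. -/

/-! ### The binomial random graph as a product measure -/

open MeasureTheory in
theorem SimpleGraph.binomialRandom_real_singleton_eq_prod {V : Type*} [Fintype V] [DecidableEq V]
    (p : unitInterval) (G : SimpleGraph V) [DecidableRel G.Adj] :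
    (SimpleGraph.binomialRandom V p).real {G} =
      ∏ e : Sym2 V with ¬ e.IsDiag, if e ∈ G.edgeSet then (p : ℝ) else 1 - p := by
  have h1 : (Finset.univ.filter fun e : Sym2 V => ¬ e.IsDiag).filter (· ∈ G.edgeSet)
      = G.edgeFinset := by
    ext e
    simp only [Finset.mem_filter, Finset.mem_univ, true_and, SimpleGraph.mem_edgeFinset]
    exact ⟨fun h => h.2, fun h => ⟨G.not_isDiag_of_mem_edgeSet h, h⟩⟩
  have h2 : (Finset.univ.filter fun e : Sym2 V => ¬ e.IsDiag).card = (Nat.card V).choose 2 := by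
    rw [Nat.card_eq_fintype_card, ← Sym2.card_subtype_not_diag, Fintype.card_subtype]
  have h3 := Finset.card_filter_add_card_filter_not
    (s := Finset.univ.filter fun e : Sym2 V => ¬ e.IsDiag) (· ∈ G.edgeSet)
  rw [h1, h2] at h3
  rw [Finset.prod_ite, Finset.prod_const, Finset.prod_const, h1, measureReal_def,
    SimpleGraph.binomialRandom_singleton, Set.ncard_eq_toFinset_card', SimpleGraph.edgeFinset]
  rw [SimpleGraph.edgeFinset] at h3
  rw [← h3, Nat.add_sub_cancel_left]
  simp

/-- Independence of the edges: the expectation of a product over pairs factorizes. -/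
theorem SimpleGraph.sum_binomialRandom_mul_prod {V : Type*} [Fintype V] [DecidableEq V]
    (p : unitInterval) (φ ψ : Sym2 V → ℝ) :
    ∑ G : SimpleGraph V, (SimpleGraph.binomialRandom V p).real {G} *
      (∏ e : Sym2 V with ¬ e.IsDiag, open Classical in if e ∈ G.edgeSet then φ e else ψ e) =
      ∏ e : Sym2 V with ¬ e.IsDiag, (p * φ e + (1 - p) * ψ e) := by
  classical
  rw [Finset.prod_add]
  refine Finset.sum_bij' (fun G _ => G.edgeFinset) (fun T _ => SimpleGraph.fromEdgeSet (T : Set (Sym2 V)))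
    ?_ ?_ ?_ ?_ ?_
  · intro G _
    rw [Finset.mem_powerset]
    intro e he
    simp only [Finset.mem_filter, Finset.mem_univ, true_and]
    exact G.not_isDiag_of_mem_edgeSet (SimpleGraph.mem_edgeFinset.1 he)
  · simp
  · intro G _
    simp
  · intro T hT
    rw [Finset.mem_powerset] at hT
    ext e
    simp only [SimpleGraph.mem_edgeFinset, SimpleGraph.edgeSet_fromEdgeSet, Set.mem_sdiff,
      Finset.mem_coe]
    refine ⟨fun h => h.1, fun h => ⟨h, ?_⟩⟩
    simpa using hT h
  · intro G _
    rw [SimpleGraph.binomialRandom_real_singleton_eq_prod, ← Finset.prod_mul_distrib]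
    have h1 : (Finset.univ.filter fun e : Sym2 V => ¬ e.IsDiag).filter (· ∈ G.edgeSet)
        = G.edgeFinset := by
      ext e
      simp only [Finset.mem_filter, Finset.mem_univ, true_and, SimpleGraph.mem_edgeFinset]
      exact ⟨fun h => h.2, fun h => ⟨G.not_isDiag_of_mem_edgeSet h, h⟩⟩
    have h2 : (Finset.univ.filter fun e : Sym2 V => ¬ e.IsDiag).filter (· ∉ G.edgeSet)
        = (Finset.univ.filter fun e : Sym2 V => ¬ e.IsDiag) \ G.edgeFinset := by
      ext e
      simp
    rw [← h1, ← Finset.prod_filter_mul_prod_filter_not _ (· ∈ G.edgeSet), h1, ← h2]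
    congr 1
    · refine Finset.prod_congr rfl fun e he => ?_
      simp [SimpleGraph.mem_edgeFinset.1 he]
    · refine Finset.prod_congr rfl fun e he => ?_
      simp [(Finset.mem_filter.1 he).2]

open MeasureTheory in
theorem SimpleGraph.binomialRandom_real_le_sum {V : Type*} [Fintype V] [DecidableEq V]
    (p : unitInterval) (E : Set (SimpleGraph V)) (Z : SimpleGraph V → ℝ)
    (h0 : ∀ G, 0 ≤ Z G) (h1 : ∀ G ∈ E, 1 ≤ Z G) :
    (SimpleGraph.binomialRandom V p).real E ≤
      ∑ G : SimpleGraph V, (SimpleGraph.binomialRandom V p).real {G} * Z G := by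
  classical
  have : E = ⋃ G ∈ (Finset.univ.filter (· ∈ E)), {G} := by ext; simp
  calc _ ≤ ∑ G ∈ Finset.univ.filter (· ∈ E), (SimpleGraph.binomialRandom V p).real {G} := by
        conv_lhs => rw [this]
        exact measureReal_biUnion_finset_le _ _
    _ ≤ ∑ G ∈ Finset.univ.filter (· ∈ E), (SimpleGraph.binomialRandom V p).real {G} * Z G := by
        refine Finset.sum_le_sum fun G hG => ?_
        exact le_mul_of_one_le_right measureReal_nonneg (h1 G (Finset.mem_filter.1 hG).2)
    _ ≤ _ := Finset.sum_le_sum_of_subset_of_nonneg (Finset.filter_subset _ _)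
        fun G _ _ => mul_nonneg measureReal_nonneg (h0 G)

/-! ### Exponential moments of degrees -/

/-- The number of ends of the edge `e` that lie in `X`. -/
def Sym2.endsIn {V : Type*} [DecidableEq V] (X : Finset V) (e : Sym2 V) : ℕ :=
  (X.filter (· ∈ e)).card

theorem Sym2.endsIn_le_two {V : Type*} [DecidableEq V] (X : Finset V) (e : Sym2 V) :
    e.endsIn X ≤ 2 := by
  induction e with
  | _ a b =>
    refine (Finset.card_le_card (t := {a, b}) ?_).trans Finset.card_le_two
    intro x hx
    simpa using (Finset.mem_filter.1 hx).2

/-- Expanding the square counts triples `(e, x, y)` with `x, y ∈ e`: at most `|V|` edges when `x =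
y`, and at most one when `x ≠ y`. -/
theorem Sym2.sum_endsIn_sq_le {V : Type*} [Fintype V] [DecidableEq V] (X : Finset V) :
    ∑ e : Sym2 V with ¬ e.IsDiag, (e.endsIn X) ^ 2 ≤ Fintype.card V * X.card + X.card ^ 2 := by
  have h (e : Sym2 V) : e.endsIn X ^ 2 = ∑ x ∈ X, ∑ y ∈ X, if x ∈ e ∧ y ∈ e then 1 else 0 := by
    rw [sq, Sym2.endsIn, Finset.card_filter, Finset.sum_mul_sum]
    refine Finset.sum_congr rfl fun x _ => Finset.sum_congr rfl fun y _ => ?_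
    by_cases hx : x ∈ e <;> by_cases hy : y ∈ e <;> simp [hx, hy]
  simp_rw [h]
  rw [Finset.sum_comm]
  have key : ∀ x ∈ X, ∑ e : Sym2 V with ¬ e.IsDiag, ∑ y ∈ X, (if x ∈ e ∧ y ∈ e then 1 else 0)
      ≤ Fintype.card V + X.card := by
    intro x hx
    rw [Finset.sum_comm, ← Finset.add_sum_erase X _ hx]
    refine Nat.add_le_add ?_ ?_
    · rw [← Finset.card_filter]
      refine (Finset.card_le_card (t := Finset.univ.image fun z : V => s(x, z)) ?_).trans
        Finset.card_image_le
      intro e he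
      simp only [Finset.mem_filter] at he
      obtain ⟨z, rfl⟩ := he.2.1
      simp
    · refine (Finset.sum_le_card_nsmul _ _ 1 ?_).trans ?_
      · intro y hy
        rw [← Finset.card_filter]
        refine (Finset.card_le_card (t := {s(x, y)}) ?_).trans (Finset.card_singleton _).le
        intro e he
        simp only [Finset.mem_filter] at he
        simpa using ((Sym2.mem_and_mem_iff (Finset.ne_of_mem_erase hy).symm).1 he.2)
      · simp only [smul_eq_mul, mul_one]
        exact Finset.card_le_card (Finset.erase_subset _ _)
  refine (Finset.sum_le_card_nsmul _ _ _ key).trans ?_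
  rw [smul_eq_mul]
  exact le_of_eq (by ring)

theorem SimpleGraph.sum_degree_eq_sum_endsIn {V : Type*} [Fintype V] [DecidableEq V]
    (G : SimpleGraph V) [DecidableRel G.Adj] (X : Finset V) :
    ∑ x ∈ X, G.degree x = ∑ e ∈ G.edgeFinset, e.endsIn X := by
  simp_rw [Sym2.endsIn, Finset.card_filter]
  rw [Finset.sum_comm]
  refine Finset.sum_congr rfl fun x _ => ?_
  rw [← Finset.card_filter, ← SimpleGraph.card_incidenceFinset_eq_degree,
    SimpleGraph.incidenceFinset_eq_filter]

open Classical in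
/-- A Chernoff bound for the degrees of all vertices of `X`, in the presence of the edges `F`. -/
theorem SimpleGraph.binomialRandom_forall_degree_le {V : Type*} [Fintype V]
    (p : unitInterval) (F : Finset (Sym2 V)) (X : Finset V) (K : ℕ) (hF : ∀ e ∈ F, ¬ e.IsDiag) :
    (SimpleGraph.binomialRandom V p).real
      {G | (∀ e ∈ F, e ∈ G.edgeSet) ∧ ∀ x ∈ X, K ≤ G.degree x} ≤
      (p : ℝ) ^ F.card * 3 ^ (∑ e ∈ F, e.endsIn X) *
        Real.exp (2 * p * (Fintype.card V * X.card + X.card ^ 2)) / 3 ^ (K * X.card) := by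
  have hp0 : (0 : ℝ) ≤ p := p.2.1
  have hp1 : (p : ℝ) ≤ 1 := p.2.2
  set U : Finset (Sym2 V) := Finset.univ.filter fun e => ¬ e.IsDiag with hU
  -- Weight `0` for an absent edge of `F` makes the product vanish unless all of `F` is present.
  set ψ : Sym2 V → ℝ := fun e => if e ∈ F then 0 else 1 with hψ
  have hψ0 : ∀ e, 0 ≤ ψ e := fun e => by simp only [hψ]; split_ifs <;> norm_num
  set Z : SimpleGraph V → ℝ := fun G =>
    (∏ e ∈ U, if e ∈ G.edgeSet then (3 : ℝ) ^ e.endsIn X else ψ e) / 3 ^ (K * X.card) with hZ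
  have h0 : ∀ G, 0 ≤ Z G := by
    intro G
    refine div_nonneg (Finset.prod_nonneg fun e _ => ?_) (by positivity)
    split_ifs
    · positivity
    · exact hψ0 e
  refine (SimpleGraph.binomialRandom_real_le_sum p _ Z h0 ?_).trans ?_
  · rintro G ⟨hG, hdeg⟩
    rw [hZ]
    simp only
    rw [one_le_div (by positivity)]
    have : (∏ e ∈ U, if e ∈ G.edgeSet then (3 : ℝ) ^ e.endsIn X else ψ e) =
        3 ^ (∑ x ∈ X, G.degree x) := by
      rw [SimpleGraph.sum_degree_eq_sum_endsIn, ← Finset.prod_pow_eq_pow_sum]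
      have hsub : G.edgeFinset ⊆ U := fun e he => by
        simpa [hU] using G.not_isDiag_of_mem_edgeSet (SimpleGraph.mem_edgeFinset.1 he)
      rw [← Finset.prod_subset hsub]
      · exact Finset.prod_congr rfl fun e he => by simp [SimpleGraph.mem_edgeFinset.1 he]
      · intro e _ he
        have he' : e ∉ G.edgeSet := by simpa using he
        have : e ∉ F := fun h => he' (hG e h)
        simp [he', hψ, this]
    rw [this]
    refine pow_le_pow_right₀ (by norm_num) ?_
    rw [mul_comm, ← smul_eq_mul]
    exact Finset.card_nsmul_le_sum _ _ _ hdeg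
  · simp only [hZ]
    simp_rw [← mul_div_assoc]
    rw [← Finset.sum_div]
    refine div_le_div_of_nonneg_right ?_ (by positivity)
    have := SimpleGraph.sum_binomialRandom_mul_prod p (fun e => (3 : ℝ) ^ e.endsIn X) ψ
    rw [← hU] at this
    have hFU : F ⊆ U := fun e he => by simpa [hU] using hF e he
    calc _ = ∏ e ∈ U, (p * (3 : ℝ) ^ e.endsIn X + (1 - p) * ψ e) := by
          rw [← this]
      _ ≤ ∏ e ∈ U, ((if e ∈ F then p * (3 : ℝ) ^ e.endsIn X else 1) *
            Real.exp (2 * p * ((e.endsIn X ^ 2 : ℕ) : ℝ))) := by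
          refine Finset.prod_le_prod (fun e _ => ?_) fun e _ => ?_
          · have := hψ0 e
            have := sub_nonneg.2 hp1
            positivity
          · by_cases he : e ∈ F
            · simp only [hψ, he, if_true, mul_zero, add_zero]
              exact le_mul_of_one_le_right (by positivity) (Real.one_le_exp (by positivity))
            · simp only [hψ, he, if_false, mul_one, one_mul]
              -- Equality holds at all three values `0, 1, 2`.
              have h3 : (3 : ℝ) ^ e.endsIn X ≤ 1 + 2 * ((e.endsIn X ^ 2 : ℕ) : ℝ) := by
                have := e.endsIn_le_two X
                interval_cases e.endsIn X <;> norm_num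
              have := Real.add_one_le_exp (2 * (p : ℝ) * ((e.endsIn X ^ 2 : ℕ) : ℝ))
              nlinarith
      _ = (p : ℝ) ^ F.card * 3 ^ (∑ e ∈ F, e.endsIn X) *
            Real.exp (∑ e ∈ U, 2 * p * ((e.endsIn X ^ 2 : ℕ) : ℝ)) := by
          rw [Finset.prod_mul_distrib, Real.exp_sum]
          congr 1
          rw [Finset.prod_ite_mem, Finset.inter_eq_right.2 hFU, Finset.prod_mul_distrib,
            Finset.prod_const, Finset.prod_pow_eq_pow_sum]
      _ ≤ _ := by
          gcongr
          rw [← Finset.mul_sum]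
          refine mul_le_mul_of_nonneg_left ?_ (by positivity)
          have := Sym2.sum_endsIn_sq_le X
          rw [← Nat.cast_sum]
          refine (Nat.cast_le.2 (le_trans (le_of_eq ?_) this)).trans (le_of_eq ?_)
          · exact Finset.sum_congr (by ext; simp [hU]) fun _ _ => rfl
          · push_cast; ring

/-! ### Counting maps by their number of distinct values -/

/-- The generating function of the number of distinct values of a map, outside `A`. -/
theorem sum_pow_card_union_image_le_fin {V : Type*} [Fintype V] [DecidableEq V] {y : ℝ}
    (hy : 0 ≤ y) (r : ℕ) (A : Finset V) :
    ∑ w : Fin r → V, y ^ (A ∪ Finset.univ.image w).card ≤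
      y ^ A.card * (Fintype.card V * y + A.card + r) ^ r := by
  induction r generalizing A with
  | zero => simp
  | succ r ih =>
    rw [← (Fin.consEquiv fun _ => V).sum_comp, Fintype.sum_prod_type]
    set n : ℝ := (Fintype.card V : ℝ)
    have hn : 0 ≤ n := Nat.cast_nonneg _
    -- The first value is either new (at most `n` choices, each with an extra factor `y`) or one of
    -- the `A.card` old ones. A new value enlarges `A` by one while `r` drops by one, so the base
    -- `B` serves both cases.
    set B : ℝ := n * y + A.card + (r + 1) with hB
    have hB0 : 0 ≤ B := by positivity
    have key (u : V) : ∑ w : Fin r → V,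
        y ^ (A ∪ Finset.univ.image ((Fin.consEquiv fun _ => V) (u, w))).card ≤
        (y ^ (A.card + 1) + if u ∈ A then y ^ A.card else 0) * B ^ r := by
      have h1 (w : Fin r → V) : A ∪ Finset.univ.image ((Fin.consEquiv fun _ => V) (u, w)) =
          insert u A ∪ Finset.univ.image w := by
        ext x
        simp only [Finset.mem_union, Finset.mem_image, Finset.mem_univ, true_and,
          Fin.consEquiv_apply, Fin.exists_fin_succ, Fin.cons_zero, Fin.cons_succ,
          Finset.mem_insert]
        tauto
      simp_rw [h1]
      refine (ih (insert u A)).trans ?_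
      by_cases hu : u ∈ A
      · rw [Finset.insert_eq_of_mem hu, if_pos hu]
        refine mul_le_mul ?_ (pow_le_pow_left₀ (by positivity) ?_ _) (by positivity) (by positivity)
        · linarith [pow_nonneg hy (A.card + 1)]
        · rw [hB]; linarith
      · rw [Finset.card_insert_of_notMem hu, if_neg hu, add_zero]
        refine mul_le_mul le_rfl (pow_le_pow_left₀ (by positivity) ?_ _) (by positivity)
          (by positivity)
        rw [hB]; push_cast; linarith
    refine (Finset.sum_le_sum fun u _ => key u).trans ?_
    rw [← Finset.sum_mul, Finset.sum_add_distrib, Finset.sum_const, ← Finset.sum_filter,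
      Finset.sum_const, Finset.card_univ, nsmul_eq_mul, nsmul_eq_mul]
    have : (Finset.univ.filter (· ∈ A)).card = A.card := by simp
    rw [this]
    push_cast
    rw [← hB, pow_succ B]
    have h2 : n * y ^ (A.card + 1) + A.card * y ^ A.card ≤ y ^ A.card * B := by
      have : 0 ≤ y ^ A.card * ((r : ℝ) + 1) := by positivity
      rw [hB, pow_succ]
      linarith
    calc _ ≤ (y ^ A.card * B) * B ^ r := mul_le_mul_of_nonneg_right h2 (by positivity)
      _ = _ := by ring

theorem sum_pow_card_union_image_le {V ι : Type*} [Fintype V] [DecidableEq V] [Fintype ι]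
    [DecidableEq ι] {y : ℝ} (hy : 0 ≤ y) (A : Finset V) :
    ∑ w : ι → V, y ^ (A ∪ Finset.univ.image w).card ≤
      y ^ A.card * (Fintype.card V * y + A.card + Fintype.card ι) ^ Fintype.card ι := by
  refine le_trans (le_of_eq ?_) (sum_pow_card_union_image_le_fin hy (Fintype.card ι) A)
  rw [← ((Fintype.equivFin ι).arrowCongr (Equiv.refl V)).sum_comp]
  refine Finset.sum_congr rfl fun w _ => ?_
  congr 3
  ext x
  simp only [Finset.mem_image, Finset.mem_univ, true_and, Equiv.arrowCongr_apply,
    Function.comp_apply, Equiv.refl_apply]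
  exact (Fintype.equivFin ι).symm.surjective.exists

/-! ### Depth in the self-avoiding walk tree and the cutset -/

namespace SimpleGraph

variable {V : Type*} {G : SimpleGraph V} {v : V}

/-- The initial segment of length `i` of a self-avoiding walk. -/
def SAW.take (x : SAW G v) (i : ℕ) : SAW G v :=
  ⟨x.walk.getVert i, x.walk.take i, x.isPath.take i⟩

theorem SAW.take_isInitialSegment (x : SAW G v) (i : ℕ) : (x.take i).IsInitialSegment x :=
  ⟨x.walk.drop i, (x.walk.append_take_drop_eq i).symm⟩

theorem SAW.IsParent.length_eq {x y : SAW G v} (h : x.IsParent y) :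
    y.walk.length = x.walk.length + 1 := by
  obtain ⟨h, e⟩ := h
  rw [e, Walk.length_concat]

theorem SAW.IsParent.sawTree_adj {x y : SAW G v} (h : x.IsParent y) : (sawTree G v).Adj x y := by
  rw [sawTree, fromRel_adj]
  refine ⟨?_, Or.inl h⟩
  rintro rfl
  have := h.length_eq
  omega

/-- The path runs towards `v`, so that its first edge, removed by the induction, is the last step of
the self-avoiding walk. -/
theorem SAW.exists_walk_length_eq {u : V} (p : G.Walk u v) (hp : p.IsPath) (x : SAW G v)
    (hx : x = ⟨u, p.reverse, hp.reverse⟩) :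
    ∃ w : (sawTree G v).Walk x (SAW.root G v), w.length = p.length := by
  subst hx
  induction p with
  | nil => exact ⟨Walk.nil, rfl⟩
  | @cons a b c h p ih =>
    obtain ⟨w, hw⟩ := ih hp.of_cons
    have hpar : SAW.IsParent (⟨b, p.reverse, hp.of_cons.reverse⟩ : SAW G c)
        ⟨a, (Walk.cons h p).reverse, hp.reverse⟩ :=
      ⟨h.symm, by simp [Walk.concat_eq_append]⟩
    exact ⟨Walk.cons hpar.sawTree_adj.symm w, by simp [hw]⟩

theorem SAW.length_le_add_length {x y : SAW G v} (w : (sawTree G v).Walk x y) :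
    y.walk.length ≤ x.walk.length + w.length := by
  induction w with
  | nil => simp
  | cons h _ ih =>
    rw [Walk.length_cons]
    rw [sawTree, fromRel_adj] at h
    rcases h.2 with h | h <;> have := h.length_eq <;> omega

/-- Each tree edge changes the length of the walk by exactly one, and stripping last steps reaches
the root. -/
theorem sawTree_dist_root (x : SAW G v) :
    (sawTree G v).dist (SAW.root G v) x = x.walk.length := by
  obtain ⟨w, hw⟩ := SAW.exists_walk_length_eq x.walk.reverse x.isPath.reverse x (by simp)
  have hw' : w.reverse.length = x.walk.length := by simpa using hw
  refine le_antisymm (hw' ▸ dist_le w.reverse) ?_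
  obtain ⟨w', hw'⟩ := Reachable.exists_walk_length_eq_dist ⟨w.reverse⟩
  rw [← hw']
  simpa [SAW.root] using SAW.length_le_add_length w'

/-- A permissive cutset exists at depths `[t, 2t)`, provided that each path of length `2a+1`
from `v` has a permissive vertex among its last `a` vertices. -/
theorem exists_isPermissiveCutset [Fintype V] {q : ℕ} (L : V → Finset (Fin q)) (A : Set V) {t : ℝ}
    {a : ℕ} (ht : ⌈t⌉₊ = a + 2) (hA : ENNReal.ofReal (2 * t) < (G.distToSet v A : ENNReal))
    (hgood : ∀ f : Fin (2 * a + 1 + 1) → V, f 0 = v → Function.Injective f →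
      (∀ i : Fin (2 * a + 1), G.Adj (f i.castSucc) (f i.succ)) →
      ∃ i : Fin (2 * a + 1 + 1), a + 2 ≤ (i : ℕ) ∧ G.IsPermissive L (f i)) :
    ∃ S : Set (SAW G v), G.IsPermissiveCutset L v A S ∧ ∀ x ∈ S,
      t ≤ ((G.sawTree v).dist (SAW.root G v) x : ℝ) ∧
      ((G.sawTree v).dist (SAW.root G v) x : ℝ) < 2 * t := by
  have hceil : (a : ℝ) + 2 < t + 1 := by
    have h0 : 0 < t := by
      rw [← Nat.ceil_pos, ht]; omega
    have := Nat.ceil_lt_add_one h0.le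
    rw [ht] at this
    exact_mod_cast this
  have hle : t ≤ (a : ℝ) + 2 := by
    have := Nat.le_ceil t
    rw [ht] at this
    exact_mod_cast this
  have hdist : ∀ w ∈ A, ∀ m : ℕ, G.edist v w ≤ m → 2 * t < m := by
    intro w hw m hm
    have h1 : G.distToSet v A ≤ m := (iInf₂_le w hw).trans hm
    have h2 : ENNReal.ofReal (2 * t) < m :=
      lt_of_lt_of_le hA (by simpa using ENat.toENNReal_le.2 h1)
    rw [← ENNReal.ofReal_natCast] at h2
    exact (ENNReal.ofReal_lt_ofReal_iff_of_nonneg (by linarith)).1 h2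
  -- The upper limit is `2t - 1`, not `2t`: one more step from `x.last` still cannot reach `A`.
  refine ⟨{x | t ≤ x.walk.length ∧ (x.walk.length : ℝ) + 1 < 2 * t ∧ G.IsPermissive L x.last},
    ⟨⟨?_, ?_, ?_⟩, fun x hx => hx.2.2⟩, fun x hx => ?_⟩
  · rintro x ⟨hx, -, -⟩ hxv
    have h0 : x.walk.length ≠ 0 := by
      intro h
      rw [h] at hx
      push_cast at hx
      linarith
    obtain ⟨u, w, hp⟩ := x
    simp only at hxv
    subst hxv
    exact h0 (Walk.length_eq_zero_iff.2 (Walk.isPath_iff_nil.1 hp))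
  · rintro x ⟨-, hx, -⟩
    refine le_iInf₂ fun w hw => ?_
    by_contra! h
    have h1 : G.edist x.last w ≤ 1 := by simpa using h
    have h2 : G.edist v w ≤ ((x.walk.length + 1 : ℕ) : ℕ∞) := by
      refine (SimpleGraph.edist_triangle (v := x.last)).trans ?_
      push_cast
      exact add_le_add (edist_le x.walk) h1
    have := hdist w hw _ h2
    push_cast at this
    linarith
  · intro w hw
    have hlen := hdist w.last hw w.walk.length (edist_le w.walk)
    have hlen' : 2 * a + 1 ≤ w.walk.length := by
      have : (2 * a + 1 : ℝ) < w.walk.length := by linarith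
      exact_mod_cast this.le
    obtain ⟨i, hi, hperm⟩ := hgood (fun i => w.walk.getVert i) (by simp)
      (fun i j hij => Fin.ext (w.isPath.getVert_injOn (by simp; omega) (by simp; omega) hij))
      (fun i => by
        simpa using w.walk.adj_getVert_succ (i := i) (by omega))
    have hl : (w.take i).walk.length = i := by
      simp only [SAW.take, Walk.take_length]
      omega
    refine ⟨w.take i, ⟨?_, ?_, hperm⟩, w.take_isInitialSegment i⟩
    · rw [hl]
      have : ((a + 2 : ℕ) : ℝ) ≤ (i : ℕ) := Nat.cast_le.2 hi
      push_cast at this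
      linarith
    · rw [hl]
      have : (((i : ℕ) : ℝ)) ≤ ((2 * a + 1 : ℕ) : ℝ) := Nat.cast_le.2 (by omega)
      push_cast at this
      linarith
  · rw [sawTree_dist_root]
    exact ⟨hx.1, by linarith [hx.2.1]⟩

end SimpleGraph

/-! ### The probability of a bad path -/

/-- The indices in the second half of the path that are not within distance `1` of `J`. -/
def uncoveredIndices (a : ℕ) (J : Finset (Fin (2 * a + 1 + 1))) : Finset (Fin (2 * a + 1 + 1)) :=
  Finset.univ.filter fun i => a + 2 ≤ (i : ℕ) ∧
    ∀ j ∈ J, j ≠ i ∧ (j : ℕ) + 1 ≠ i ∧ (i : ℕ) + 1 ≠ j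

/-- Each index in `J` covers at most itself and its two neighbors among the `a` indices `a+2, …,
2a+1`. -/
theorem le_card_add_card_uncoveredIndices (a : ℕ) (J : Finset (Fin (2 * a + 1 + 1))) :
    a ≤ 3 * J.card + (uncoveredIndices a J).card := by
  set N : Fin (2 * a + 1 + 1) → Finset (Fin (2 * a + 1 + 1)) := fun j =>
    Finset.univ.filter fun i => j = i ∨ (j : ℕ) + 1 = i ∨ (i : ℕ) + 1 = j
  have hN : ∀ j ∈ J, (N j).card ≤ 3 := by
    intro j _
    refine (Finset.card_le_card_of_injOn (t := {(j : ℕ), (j : ℕ) + 1, (j : ℕ) - 1})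
      (fun i : Fin (2 * a + 1 + 1) => (i : ℕ)) ?_ Fin.val_injective.injOn).trans Finset.card_le_three
    intro i hi
    simp only [N, Finset.coe_filter, Finset.mem_univ, true_and, Set.mem_ofPred_eq, Fin.ext_iff] at hi
    simp only [Finset.coe_insert, Finset.coe_singleton, Set.mem_insert_iff, Set.mem_singleton_iff]
    omega
  have h1 : a ≤ (J.biUnion N ∪ uncoveredIndices a J).card := by
    calc a = (Finset.univ : Finset (Fin a)).card := by simp
      _ ≤ _ := by
        refine Finset.card_le_card_of_injOn
          (fun i => (⟨a + 2 + i, by omega⟩ : Fin (2 * a + 1 + 1))) ?_ ?_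
        · intro i _
          simp only [uncoveredIndices, N, Finset.coe_union, Finset.coe_biUnion, Finset.coe_filter,
            Set.mem_union, Set.mem_iUnion, Finset.mem_univ, true_and, Set.mem_ofPred_eq,
            Finset.mem_coe]
          by_contra! h
          obtain ⟨j, hj, h3⟩ := h.2 (by simp)
          have := h.1 j hj
          tauto
        · intro i _ j _ hij
          simpa [Fin.ext_iff] using hij
  have h2 := Finset.card_union_le (J.biUnion N) (uncoveredIndices a J)
  have h3 : (J.biUnion N).card ≤ J.card * 3 := Finset.card_biUnion_le_card_mul _ _ _ hN
  omega

section PathEvents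

variable {V : Type*} {a : ℕ}

/-- The edges of the path `f`. -/
def pathEdges [DecidableEq V] (f : Fin (2 * a + 1 + 1) → V) : Finset (Sym2 V) :=
  Finset.univ.image fun i : Fin (2 * a + 1) => s(f i.castSucc, f i.succ)

/-- The edges that join the uncovered vertices of the path `f` to the chosen vertices `w`. -/
def witnessEdges [DecidableEq V] (f : Fin (2 * a + 1 + 1) → V) (J : Finset (Fin (2 * a + 1 + 1)))
    (w : uncoveredIndices a J → V) : Finset (Sym2 V) :=
  Finset.univ.image fun i : uncoveredIndices a J => s(f i, w i)

theorem pathEdge_injective {f : Fin (2 * a + 1 + 1) → V} (hf : Function.Injective f) :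
    Function.Injective fun i : Fin (2 * a + 1) => s(f i.castSucc, f i.succ) := by
  intro i j h
  rcases Sym2.eq_iff.1 h with ⟨h, -⟩ | ⟨h1, h2⟩
  · exact Fin.castSucc_injective _ (hf h)
  · have h1 := congrArg Fin.val (hf h1)
    have h2 := congrArg Fin.val (hf h2)
    simp only [Fin.val_castSucc, Fin.val_succ] at h1 h2
    omega

theorem notMem_of_mem_uncoveredIndices {J : Finset (Fin (2 * a + 1 + 1))}
    {i : Fin (2 * a + 1 + 1)} (hi : i ∈ uncoveredIndices a J) : i ∉ J :=
  fun h => ((Finset.mem_filter.1 hi).2.2 i h).1 rfl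

variable {f : Fin (2 * a + 1 + 1) → V} {J : Finset (Fin (2 * a + 1 + 1))}
  {w : uncoveredIndices a J → V}

/-- Two witness edges could coincide only crosswise, which would put an uncovered index into `J`. -/
theorem witnessEdge_injective (hf : Function.Injective f) (hw : ∀ i k, w i = f k → k ∈ J) :
    Function.Injective fun i : uncoveredIndices a J => s(f i, w i) := by
  intro i j h
  rcases Sym2.eq_iff.1 h with ⟨h, -⟩ | ⟨h, -⟩
  · exact Subtype.ext (hf h)
  · exact absurd (hw _ _ h.symm) (notMem_of_mem_uncoveredIndices i.2)

/-- A witness edge along the path would join an uncovered index to a neighboring index in `J`. Hence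
the witness edges are new and contribute their own factors `p`. -/
theorem disjoint_pathEdges_witnessEdges [DecidableEq V] (hf : Function.Injective f)
    (hw : ∀ i k, w i = f k → k ∈ J) : Disjoint (pathEdges f) (witnessEdges f J w) := by
  rw [Finset.disjoint_left]
  intro e he he'
  obtain ⟨k, -, rfl⟩ := Finset.mem_image.1 he
  obtain ⟨i, -, h⟩ := Finset.mem_image.1 he'
  have hi := (Finset.mem_filter.1 i.2).2.2
  rcases Sym2.eq_iff.1 h with ⟨h1, h2⟩ | ⟨h1, h2⟩
  · have := (hi _ (hw _ _ h2)).2.2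
    rw [hf h1] at this
    simp at this
  · have := (hi _ (hw _ _ h2)).2.1
    rw [hf h1] at this
    simp at this

/-- A vertex lies on at most two path edges; this is the source of the `9 = 3^2` in `y`. -/
theorem sum_pathEdges_endsIn_le [DecidableEq V] (hf : Function.Injective f) (X : Finset V) :
    ∑ e ∈ pathEdges f, e.endsIn X ≤ 2 * X.card := by
  rw [pathEdges, Finset.sum_image (pathEdge_injective hf).injOn]
  simp_rw [Sym2.endsIn, Finset.card_filter]
  rw [Finset.sum_comm]
  refine (Finset.sum_le_card_nsmul _ _ 2 fun x _ => ?_).trans_eq (mul_comm _ _)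
  rw [← Finset.card_filter]
  simp_rw [Sym2.mem_iff, Finset.filter_or]
  refine (Finset.card_union_le _ _).trans (Nat.add_le_add (b := 1) (d := 1) ?_ ?_) <;>
  · rw [Finset.card_le_one]
    intro i hi j hj
    have hi := (Finset.mem_filter.1 hi).2
    have hj := (Finset.mem_filter.1 hj).2
    simpa using hf (hi.symm.trans hj)

theorem sum_witnessEdges_endsIn_le [DecidableEq V] (X : Finset V) :
    ∑ e ∈ witnessEdges f J w, e.endsIn X ≤ 2 * (uncoveredIndices a J).card := by
  refine (Finset.sum_le_card_nsmul _ _ 2 fun e _ => e.endsIn_le_two X).trans ?_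
  rw [smul_eq_mul, mul_comm]
  refine Nat.mul_le_mul le_rfl (Finset.card_image_le.trans ?_)
  simp

open Classical in
/-- A bound for the probability that `f` is a path, its uncovered vertices are joined to
the vertices `w`, and the vertices `w` and `f j`, for `j ∈ J`, have high degree. -/
theorem binomialRandom_witness_le [Fintype V] (p : unitInterval) {d y : ℝ} {K : ℕ}
    (hf : Function.Injective f) (hw : ∀ i k, w i = f k → k ∈ J)
    (hp : p * (Fintype.card V : ℝ) ≤ d) (hpa : 2 * (p : ℝ) * (4 * a + 4) ^ 2 ≤ 1)
    (hy : 9 * Real.exp (2 * d) ≤ y * 3 ^ K) :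
    (SimpleGraph.binomialRandom V p).real
      {G | (∀ e ∈ pathEdges f ∪ witnessEdges f J w, e ∈ G.edgeSet) ∧
        ∀ x ∈ J.image f ∪ Finset.univ.image w, K ≤ G.degree x} ≤
      p ^ (2 * a + 1) * (3 * (9 * p) ^ (uncoveredIndices a J).card *
        y ^ (J.image f ∪ Finset.univ.image w).card) := by
  have hp0 : (0 : ℝ) ≤ p := p.2.1
  set X := J.image f ∪ Finset.univ.image w with hX
  set r := (uncoveredIndices a J).card with hr
  have hJ : J.card ≤ 2 * a + 2 := by simpa using J.card_le_univ
  have hR : r ≤ 2 * a + 2 := by simpa using (uncoveredIndices a J).card_le_univ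
  have hXc : X.card ≤ 4 * a + 4 := by
    refine (Finset.card_union_le _ _).trans ?_
    have h1 : (J.image f).card ≤ J.card := Finset.card_image_le
    have h2 : (Finset.univ.image w).card ≤ r := Finset.card_image_le.trans (by simp [hr])
    omega
  have hFc : (pathEdges f ∪ witnessEdges f J w).card = 2 * a + 1 + r := by
    rw [Finset.card_union_of_disjoint (disjoint_pathEdges_witnessEdges hf hw), pathEdges,
      witnessEdges, Finset.card_image_of_injective _ (pathEdge_injective hf),
      Finset.card_image_of_injective _ (witnessEdge_injective hf hw)]
    simp [hr]
  have hFe : ∑ e ∈ pathEdges f ∪ witnessEdges f J w, e.endsIn X ≤ 2 * X.card + 2 * r := by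
    rw [Finset.sum_union (disjoint_pathEdges_witnessEdges hf hw)]
    exact Nat.add_le_add (sum_pathEdges_endsIn_le hf X) (sum_witnessEdges_endsIn_le X)
  have hdiag : ∀ e ∈ pathEdges f ∪ witnessEdges f J w, ¬ e.IsDiag := by
    intro e he
    rcases Finset.mem_union.1 he with he | he
    · obtain ⟨k, -, rfl⟩ := Finset.mem_image.1 he
      rw [Sym2.mk_isDiag_iff]
      intro h
      have := congrArg Fin.val (hf h)
      simp at this
    · obtain ⟨i, -, rfl⟩ := Finset.mem_image.1 he
      rw [Sym2.mk_isDiag_iff]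
      exact fun h => notMem_of_mem_uncoveredIndices i.2 (hw _ _ h.symm)
  refine (SimpleGraph.binomialRandom_forall_degree_le p _ X K hdiag).trans ?_
  rw [hFc]
  -- By `hpa` the quadratic term adds at most `1` to the exponent, hence a factor `e ≤ 3`.
  have hexp : Real.exp (2 * p * (Fintype.card V * X.card + X.card ^ 2)) ≤
      Real.exp (2 * d) ^ X.card * 3 := by
    have h1 : 2 * (p : ℝ) * (Fintype.card V * X.card + X.card ^ 2) ≤ X.card * (2 * d) + 1 := by
      have h2 : (X.card : ℝ) ^ 2 ≤ (4 * a + 4) ^ 2 := by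
        gcongr
        exact_mod_cast hXc
      have h3 := mul_le_mul_of_nonneg_left h2 (by positivity : 0 ≤ 2 * (p : ℝ))
      have h4 := mul_le_mul_of_nonneg_right hp (by positivity : (0 : ℝ) ≤ X.card)
      linarith
    refine (Real.exp_le_exp.2 h1).trans ?_
    rw [Real.exp_add, Real.exp_nat_mul]
    gcongr
    linarith [Real.exp_one_lt_d9]
  have hpow : (3 : ℝ) ^ (∑ e ∈ pathEdges f ∪ witnessEdges f J w, e.endsIn X) ≤
      3 ^ (2 * X.card + 2 * r) := pow_le_pow_right₀ (by norm_num) hFe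
  rw [div_le_iff₀ (by positivity)]
  calc _ ≤ (p : ℝ) ^ (2 * a + 1 + r) * 3 ^ (2 * X.card + 2 * r) *
        (Real.exp (2 * d) ^ X.card * 3) :=
        mul_le_mul (mul_le_mul_of_nonneg_left hpow (by positivity)) hexp (by positivity)
          (by positivity)
    _ = (p : ℝ) ^ (2 * a + 1) * (3 * (9 * p) ^ r) * (9 * Real.exp (2 * d)) ^ X.card := by
        rw [pow_add (3 : ℝ), pow_mul (3 : ℝ) 2, pow_mul (3 : ℝ) 2, pow_add, mul_pow, mul_pow]
        norm_num
        ring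
    _ ≤ (p : ℝ) ^ (2 * a + 1) * (3 * (9 * p) ^ r) * (y * 3 ^ K) ^ X.card := by gcongr
    _ = _ := by rw [mul_pow y, ← pow_mul]; ring

open Classical in
/-- A bound for the probability that `f` is a path and that each vertex in its second half
has high degree or has a neighbor of high degree. -/
theorem binomialRandom_path_le [Fintype V] (p : unitInterval) {d y γ : ℝ} {K : ℕ}
    (hf : Function.Injective f) (hp : p * (Fintype.card V : ℝ) ≤ d)
    (hpa : 2 * (p : ℝ) * (4 * a + 4) ^ 2 ≤ 1) (hy : 9 * Real.exp (2 * d) ≤ y * 3 ^ K)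
    (hya : 4 * a + 4 ≤ Fintype.card V * y) (hy0 : 0 ≤ y) (hγ0 : 0 ≤ γ) (hγ1 : γ ≤ 1)
    (hyγ : y ≤ γ ^ 3) (hdy : 18 * d * y ≤ γ) :
    (SimpleGraph.binomialRandom V p).real
      {G | (∀ i : Fin (2 * a + 1), G.Adj (f i.castSucc) (f i.succ)) ∧
        ∀ i : Fin (2 * a + 1 + 1), a + 2 ≤ (i : ℕ) →
          ∃ u, (u = f i ∨ G.Adj (f i) u) ∧ K ≤ G.degree u} ≤
      p ^ (2 * a + 1) * (12 * 4 ^ a * γ ^ a) := by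
  have hp0 : (0 : ℝ) ≤ p := p.2.1
  -- Including the condition on `w` in the event makes it empty for inadmissible `w`, so the union
  -- bound can run over all maps.
  set E : (J : Finset (Fin (2 * a + 1 + 1))) → (uncoveredIndices a J → V) →
    Set (SimpleGraph V) := fun J w => {G | (∀ i k, w i = f k → k ∈ J) ∧
      (∀ e ∈ pathEdges f ∪ witnessEdges f J w, e ∈ G.edgeSet) ∧
        ∀ x ∈ J.image f ∪ Finset.univ.image w, K ≤ G.degree x} with hE
  have hEle (J) (w) : (SimpleGraph.binomialRandom V p).real (E J w) ≤
      p ^ (2 * a + 1) * (3 * (9 * p) ^ (uncoveredIndices a J).card *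
        y ^ (J.image f ∪ Finset.univ.image w).card) := by
    by_cases hw : ∀ i k, w i = f k → k ∈ J
    · refine le_trans (le_of_eq ?_) (binomialRandom_witness_le p hf hw hp hpa hy)
      congr 1
      ext G
      simp only [hE, Set.mem_ofPred_eq]
      exact ⟨fun h => h.2, fun h => ⟨hw, h⟩⟩
    · have : E J w = ∅ := by
        ext G
        simp only [hE, Set.mem_ofPred_eq, Set.mem_empty_iff_false, iff_false]
        exact fun h => hw h.1
      rw [this, MeasureTheory.measureReal_empty]
      positivity
  have hsub : {G : SimpleGraph V | (∀ i : Fin (2 * a + 1), G.Adj (f i.castSucc) (f i.succ)) ∧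
        ∀ i : Fin (2 * a + 1 + 1), a + 2 ≤ (i : ℕ) →
          ∃ u, (u = f i ∨ G.Adj (f i) u) ∧ K ≤ G.degree u} ⊆ ⋃ J, ⋃ w, E J w := by
    rintro G ⟨hadj, hdeg⟩
    -- Taking all high-degree indices forces any witness lying on the path to have its index in `J`.
    set J : Finset (Fin (2 * a + 1 + 1)) := Finset.univ.filter fun j => K ≤ G.degree (f j) with hJ
    have hJmem (j) : j ∈ J ↔ K ≤ G.degree (f j) := by simp [hJ]
    have hex : ∀ i : uncoveredIndices a J, ∃ u, G.Adj (f i) u ∧ K ≤ G.degree u := by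
      intro i
      obtain ⟨u, hu, hK⟩ := hdeg i (Finset.mem_filter.1 i.2).2.1
      rcases hu with rfl | hu
      · exact absurd ((hJmem _).2 hK) (notMem_of_mem_uncoveredIndices i.2)
      · exact ⟨u, hu, hK⟩
    choose w hw hwK using hex
    rw [Set.mem_iUnion]
    refine ⟨J, ?_⟩
    rw [Set.mem_iUnion]
    refine ⟨w, fun i k hik => (hJmem k).2 (hik ▸ hwK i), ?_, ?_⟩
    · intro e he
      rcases Finset.mem_union.1 he with he | he
      · obtain ⟨k, -, rfl⟩ := Finset.mem_image.1 he
        exact hadj k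
      · obtain ⟨i, -, rfl⟩ := Finset.mem_image.1 he
        exact hw i
    · intro x hx
      rcases Finset.mem_union.1 hx with hx | hx
      · obtain ⟨k, hk, rfl⟩ := Finset.mem_image.1 hx
        exact (hJmem k).1 hk
      · obtain ⟨i, -, rfl⟩ := Finset.mem_image.1 hx
        exact hwK i
  have hJle (J : Finset (Fin (2 * a + 1 + 1))) :
      (SimpleGraph.binomialRandom V p).real (⋃ w, E J w) ≤ p ^ (2 * a + 1) * (3 * γ ^ a) := by
    set r := (uncoveredIndices a J).card with hr
    have hJc : J.card ≤ 2 * a + 2 := by simpa using J.card_le_univ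
    have hR : r ≤ 2 * a + 2 := by simpa using (uncoveredIndices a J).card_le_univ
    -- Hence the base of the generating-function bound is at most `2ny`; with `9p` per witness edge
    -- this gives `18 d y`.
    have hJr : (J.card : ℝ) + r ≤ Fintype.card V * y := by
      refine le_trans ?_ hya
      have : J.card + r ≤ 4 * a + 4 := by omega
      exact_mod_cast this
    refine (MeasureTheory.measureReal_iUnion_fintype_le _).trans ?_
    refine (Finset.sum_le_sum fun w _ => hEle J w).trans ?_
    rw [← Finset.mul_sum, ← Finset.mul_sum]
    refine mul_le_mul_of_nonneg_left ?_ (by positivity)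
    rw [mul_assoc]
    refine mul_le_mul_of_nonneg_left ?_ (by norm_num)
    have hsum := sum_pow_card_union_image_le (ι := uncoveredIndices a J) hy0 (J.image f)
    rw [Finset.card_image_of_injective _ hf, Fintype.card_coe, ← hr] at hsum
    calc _ ≤ (9 * (p : ℝ)) ^ r * (y ^ J.card * (Fintype.card V * y + J.card + r) ^ r) := by
          refine mul_le_mul_of_nonneg_left ?_ (by positivity)
          convert hsum
      _ ≤ (9 * (p : ℝ)) ^ r * (y ^ J.card * (2 * (Fintype.card V * y)) ^ r) := by
          gcongr
          linarith
      _ = y ^ J.card * (18 * (p * Fintype.card V) * y) ^ r := by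
          rw [mul_left_comm, ← mul_pow]
          congr 2
          ring
      _ ≤ (γ ^ 3) ^ J.card * γ ^ r := by
          gcongr
          exact le_trans (by gcongr) hdy
      _ = γ ^ (3 * J.card + r) := by rw [pow_add, pow_mul]
      _ ≤ γ ^ a := pow_le_pow_of_le_one hγ0 hγ1 (le_card_add_card_uncoveredIndices a J)
  refine (MeasureTheory.measureReal_mono hsub).trans ?_
  refine (MeasureTheory.measureReal_iUnion_fintype_le _).trans ?_
  refine (Finset.sum_le_card_nsmul _ _ _ fun J _ => hJle J).trans (le_of_eq ?_)
  rw [Finset.card_univ, Fintype.card_finset, Fintype.card_fin, nsmul_eq_mul]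
  push_cast
  rw [show 2 * a + 1 + 1 = 2 * (a + 1) by ring, pow_mul]
  norm_num
  ring

open Classical in
/-- A bound for the probability that there is a path of length `2a+1` from `v` in whose second half
each vertex has high degree or has a neighbor of high degree. -/
theorem binomialRandom_exists_path_le [Fintype V] (p : unitInterval) (v : V) {d y γ : ℝ} {K : ℕ}
    (hp : p * (Fintype.card V : ℝ) ≤ d)
    (hpa : 2 * (p : ℝ) * (4 * a + 4) ^ 2 ≤ 1) (hy : 9 * Real.exp (2 * d) ≤ y * 3 ^ K)
    (hya : 4 * a + 4 ≤ Fintype.card V * y) (hy0 : 0 ≤ y) (hγ0 : 0 ≤ γ) (hγ1 : γ ≤ 1)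
    (hyγ : y ≤ γ ^ 3) (hdy : 18 * d * y ≤ γ) :
    (SimpleGraph.binomialRandom V p).real
      {G | ∃ f : Fin (2 * a + 1 + 1) → V, f 0 = v ∧ Function.Injective f ∧
        (∀ i : Fin (2 * a + 1), G.Adj (f i.castSucc) (f i.succ)) ∧
        ∀ i : Fin (2 * a + 1 + 1), a + 2 ≤ (i : ℕ) →
          ∃ u, (u = f i ∨ G.Adj (f i) u) ∧ K ≤ G.degree u} ≤
      12 * d * (4 * d ^ 2 * γ) ^ a := by
  have hp0 : (0 : ℝ) ≤ p := p.2.1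
  set E : (Fin (2 * a + 1 + 1) → V) → Set (SimpleGraph V) := fun f => {G | Function.Injective f ∧
        (∀ i : Fin (2 * a + 1), G.Adj (f i.castSucc) (f i.succ)) ∧
        ∀ i : Fin (2 * a + 1 + 1), a + 2 ≤ (i : ℕ) →
          ∃ u, (u = f i ∨ G.Adj (f i) u) ∧ K ≤ G.degree u} with hE
  have hEle (f) : (SimpleGraph.binomialRandom V p).real (E f) ≤
      p ^ (2 * a + 1) * (12 * 4 ^ a * γ ^ a) := by
    by_cases hf : Function.Injective f
    · refine le_trans (le_of_eq ?_)
        (binomialRandom_path_le p hf hp hpa hy hya hy0 hγ0 hγ1 hyγ hdy)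
      congr 1
      ext G
      simp only [hE, Set.mem_ofPred_eq]
      exact ⟨fun h => h.2, fun h => ⟨hf, h⟩⟩
    · have : E f = ∅ := by
        ext G
        simp only [hE, Set.mem_ofPred_eq, Set.mem_empty_iff_false, iff_false]
        exact fun h => hf h.1
      rw [this, MeasureTheory.measureReal_empty]
      positivity
  have hsub : {G : SimpleGraph V | ∃ f : Fin (2 * a + 1 + 1) → V, f 0 = v ∧ Function.Injective f ∧
        (∀ i : Fin (2 * a + 1), G.Adj (f i.castSucc) (f i.succ)) ∧
        ∀ i : Fin (2 * a + 1 + 1), a + 2 ≤ (i : ℕ) →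
          ∃ u, (u = f i ∨ G.Adj (f i) u) ∧ K ≤ G.degree u} ⊆
      ⋃ g : Fin (2 * a + 1) → V, E (Fin.cons v g) := by
    rintro G ⟨f, h0, h⟩
    rw [Set.mem_iUnion]
    refine ⟨Fin.tail f, ?_⟩
    rw [← h0, Fin.cons_self_tail]
    exact h
  refine (MeasureTheory.measureReal_mono hsub).trans ?_
  refine (MeasureTheory.measureReal_iUnion_fintype_le _).trans ?_
  refine (Finset.sum_le_card_nsmul _ _ _ fun g _ => hEle _).trans ?_
  rw [Finset.card_univ, Fintype.card_fun, Fintype.card_fin, nsmul_eq_mul]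
  push_cast
  rw [← mul_assoc, ← mul_pow, mul_comm (Fintype.card V : ℝ)]
  calc _ ≤ d ^ (2 * a + 1) * (12 * 4 ^ a * γ ^ a) := by gcongr
    _ = _ := by rw [mul_pow, mul_pow, ← pow_mul]; ring

end PathEvents

/-! ### Numerical and asymptotic estimates -/

/-- This amounts to `y ≤ γ^3`. Since `log 3 > 12/11`, `3^(2d)` exceeds `e^(2d)` by a factor
`e^(2d/11)`, which absorbs the growth of `d^6`; the remaining `3^22` absorbs the constants. -/
theorem pow_six_mul_exp_div_three_pow_le {d : ℝ} (hd : 1 < d) {K : ℕ} (hK : 2 * d + 22 ≤ K) :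
    512 * d ^ 6 * (9 * Real.exp (2 * d) / 3 ^ K) ≤ 1 := by
  have h1 : d ^ 6 ≤ 33 ^ 6 * (Real.exp (2 * d / 11) / Real.exp 6) := by
    -- The tangent to `exp` at `0`; the scale `33` makes the sixth power grow as `e^(2d/11)`.
    have h : d ≤ 33 * Real.exp (d / 33 - 1) := by
      linarith [Real.add_one_le_exp (d / 33 - 1)]
    calc d ^ 6 ≤ (33 * Real.exp (d / 33 - 1)) ^ 6 := by gcongr
      _ = _ := by
        rw [mul_pow, ← Real.exp_nat_mul, ← Real.exp_sub]
        congr 2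
        push_cast
        ring
  have h2 : Real.exp (2 * d) * Real.exp (2 * d / 11) * 3 ^ 22 ≤ (3 : ℝ) ^ K := by
    have h3 : (3 : ℝ) ^ 22 = Real.exp (22 * Real.log 3) := by
      rw [show (22 : ℝ) = ((22 : ℕ) : ℝ) by norm_num, Real.exp_nat_mul,
        Real.exp_log (by norm_num)]
    have h4 : (3 : ℝ) ^ K = Real.exp (K * Real.log 3) := by
      rw [Real.exp_nat_mul, Real.exp_log (by norm_num)]
    rw [h3, h4, ← Real.exp_add, ← Real.exp_add]
    refine Real.exp_le_exp.2 ?_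
    have := Real.log_three_gt_d9
    nlinarith
  have h6 : (2.7 : ℝ) ^ 6 ≤ Real.exp 6 := by
    rw [show (6 : ℝ) = ((6 : ℕ) : ℝ) * 1 by norm_num, Real.exp_nat_mul]
    gcongr
    linarith [Real.exp_one_gt_d9]
  rw [← mul_div_assoc, div_le_one (by positivity)]
  refine le_trans ?_ h2
  calc 512 * d ^ 6 * (9 * Real.exp (2 * d))
      ≤ 512 * (33 ^ 6 * (Real.exp (2 * d / 11) / Real.exp 6)) * (9 * Real.exp (2 * d)) := by gcongr
    _ = Real.exp (2 * d) * Real.exp (2 * d / 11) * (512 * 33 ^ 6 * 9 / Real.exp 6) := by ring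
    _ ≤ _ := by
      refine mul_le_mul_of_nonneg_left ?_ (by positivity)
      rw [div_le_iff₀ (by positivity)]
      norm_num at h6 ⊢
      linarith

theorem edgeProb_le {d : ℝ} (hd : 0 ≤ d) (n : ℕ) : (edgeProb d n : ℝ) ≤ d / n := by
  rw [edgeProb, Set.coe_projIcc]
  exact max_le (by positivity) (min_le_right _ _)

theorem eventually_log_div_le {c b y : ℝ} (hy : 0 < y) :
    ∀ᶠ n : ℕ in Filter.atTop,
      b * (4 * (Real.log n / c) + 4) ^ 2 ≤ n ∧ 4 * (Real.log n / c) + 4 ≤ n * y := by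
  have h1 : (fun x : ℝ => Real.log x) =o[Filter.atTop] fun x => x := Real.isLittleO_log_id_atTop
  have h2 : (fun x : ℝ => Real.log x ^ 2) =o[Filter.atTop] fun x => x :=
    Real.isLittleO_pow_log_id_atTop
  have h0 (k : ℝ) : (fun _ : ℝ => k) =o[Filter.atTop] fun x : ℝ => x :=
    Asymptotics.isLittleO_const_id_atTop k
  have h3 : (fun x : ℝ => b * (4 * (Real.log x / c) + 4) ^ 2) =o[Filter.atTop] fun x => x := by
    refine (((h2.const_mul_left (16 * b / c ^ 2)).add (h1.const_mul_left (32 * b / c))).add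
      (h0 (16 * b))).congr_left fun x => ?_
    by_cases hc : c = 0
    · simp [hc]; ring
    · field_simp; ring
  have h4 : (fun x : ℝ => 4 * (Real.log x / c) + 4) =o[Filter.atTop] fun x => x := by
    refine ((h1.const_mul_left (4 / c)).add (h0 4)).congr_left fun x => ?_
    ring
  refine tendsto_natCast_atTop_atTop.eventually
    (p := fun x : ℝ => b * (4 * (Real.log x / c) + 4) ^ 2 ≤ x ∧ 4 * (Real.log x / c) + 4 ≤ x * y) ?_
  filter_upwards [h3.bound one_pos, h4.bound hy, Filter.eventually_ge_atTop 0] with x h5 h6 hx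
  rw [Real.norm_eq_abs, Real.norm_eq_abs, abs_of_nonneg hx] at h5 h6
  exact ⟨by linarith [le_abs_self (b * (4 * (Real.log x / c) + 4) ^ 2)],
    by linarith [le_abs_self (4 * (Real.log x / c) + 4)]⟩

/-! ### Choice of constants and the union bound over depths -/

theorem lemma7 (d α β : ℝ) (q : ℕ) (hd : 1 < d) (hα : 2 < α) (hβ : 23 ≤ β)
    (hq : α * d + β ≤ (q : ℝ))
    (t₀ : ℕ → ℝ) (ht₀ : Filter.Tendsto t₀ Filter.atTop Filter.atTop) :
    ∀ ε : ℝ, 0 < ε → ∀ᶠ n : ℕ in Filter.atTop, ∀ v : Fin n,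
      1 - ε ≤ (SimpleGraph.binomialRandom (Fin n) (edgeProb d n)).real
        {G : SimpleGraph (Fin n) |
          ∀ t : ℝ, t₀ n ≤ t → t ≤ Real.log n / Real.log d →
            ∀ Δ : Set (Fin n), ENNReal.ofReal (2 * t) < (G.distToSet v Δ : ENNReal) →
              ∃ S : Set (SimpleGraph.SAW G v),
                G.IsPermissiveCutset (fun _ => (Finset.univ : Finset (Fin q))) v Δ S ∧
                ∀ x ∈ S,
                  t ≤ ((G.sawTree v).dist (SimpleGraph.SAW.root G v) x : ℝ) ∧
                  ((G.sawTree v).dist (SimpleGraph.SAW.root G v) x : ℝ) < 2 * t} := by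
  classical
  intro ε hε
  have hd0 : 0 < d := by linarith
  obtain ⟨K, rfl⟩ : ∃ K, q = K + 1 := by
    refine Nat.exists_eq_succ_of_ne_zero ?_
    rintro rfl
    push_cast at hq
    nlinarith
  have hK : 2 * d + 22 ≤ K := by
    push_cast at hq
    nlinarith
  set y : ℝ := 9 * Real.exp (2 * d) / 3 ^ K with hydef
  have hy0 : 0 < y := by positivity
  have hy : 9 * Real.exp (2 * d) ≤ y * 3 ^ K := by
    rw [hydef, div_mul_cancel₀ _ (by positivity)]
  have hyd : 512 * d ^ 6 * y ≤ 1 := pow_six_mul_exp_div_three_pow_le hd hK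
  -- Chosen so that `4 d² γ = 1/2`.
  set γ : ℝ := 1 / (8 * d ^ 2) with hγ
  have hγ0 : 0 ≤ γ := by positivity
  have hγ1 : γ ≤ 1 := by
    rw [hγ, div_le_one (by positivity)]
    nlinarith
  have hyγ : y ≤ γ ^ 3 := by
    rw [hγ, div_pow, le_div_iff₀ (by positivity)]
    linarith
  have hdy : 18 * d * y ≤ γ := by
    rw [hγ, le_div_iff₀ (by positivity)]
    have : d ^ 3 ≤ d ^ 6 := pow_le_pow_right₀ hd.le (by norm_num)
    nlinarith
  have h4γ : 4 * d ^ 2 * γ = 1 / 2 := by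
    rw [hγ]
    field_simp
    norm_num
  -- The geometric tail of `12 d 2^(-a)` from `A` on is `24 d 2^(-A)`.
  obtain ⟨A, hA⟩ : ∃ A : ℕ, (1 / 2 : ℝ) ^ A < ε / (24 * d) :=
    exists_pow_lt_of_lt_one (by positivity) (by norm_num)
  filter_upwards [ht₀.eventually_ge_atTop ((A : ℝ) + 2), Filter.eventually_gt_atTop 0,
    eventually_log_div_le (c := Real.log d) (b := 2 * d) hy0] with n hn hn0 hlog v
  have hn0' : (0 : ℝ) < n := Nat.cast_pos.2 hn0
  set p := edgeProb d n
  have hp0 : (0 : ℝ) ≤ p := p.2.1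
  have hp : (p : ℝ) * (Fintype.card (Fin n) : ℝ) ≤ d := by
    rw [Fintype.card_fin, ← le_div_iff₀ hn0']
    exact edgeProb_le hd0.le n
  set N : ℝ := Real.log n / Real.log d with hN
  have hN0 : 0 ≤ N := div_nonneg (Real.log_natCast_nonneg n) (Real.log_nonneg hd.le)
  set B : ℕ → Set (SimpleGraph (Fin n)) := fun a => {G |
    ∃ f : Fin (2 * a + 1 + 1) → Fin n, f 0 = v ∧ Function.Injective f ∧
        (∀ i : Fin (2 * a + 1), G.Adj (f i.castSucc) (f i.succ)) ∧
        ∀ i : Fin (2 * a + 1 + 1), a + 2 ≤ (i : ℕ) →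
          ∃ u, (u = f i ∨ G.Adj (f i) u) ∧ K ≤ G.degree u} with hB
  have hBle (a : ℕ) (ha : (a : ℝ) ≤ N) :
      (SimpleGraph.binomialRandom (Fin n) p).real (B a) ≤ 12 * d * (1 / 2) ^ a := by
    rw [← h4γ]
    refine le_trans (le_of_eq ?_) (binomialRandom_exists_path_le p v hp ?_ hy ?_ hy0.le
      hγ0 hγ1 hyγ hdy)
    · rfl
    · have h1 : (4 * (a : ℝ) + 4) ^ 2 ≤ (4 * N + 4) ^ 2 := by gcongr
      have h2 : 2 * d * (4 * (a : ℝ) + 4) ^ 2 ≤ n :=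
        (mul_le_mul_of_nonneg_left h1 (by positivity)).trans hlog.1
      calc 2 * (p : ℝ) * (4 * a + 4) ^ 2 ≤ 2 * (d / n) * (4 * a + 4) ^ 2 := by
            gcongr
            exact edgeProb_le hd0.le n
        _ = 2 * d * (4 * (a : ℝ) + 4) ^ 2 / n := by ring
        _ ≤ 1 := (div_le_one hn0').2 h2
    · rw [Fintype.card_fin]
      linarith [hlog.2]
  have hUle : (SimpleGraph.binomialRandom (Fin n) p).real
      (⋃ a ∈ Finset.Ico A (⌊N⌋₊ + 1), B a) ≤ ε := by
    refine (MeasureTheory.measureReal_biUnion_finset_le _ _).trans ?_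
    calc _ ≤ ∑ a ∈ Finset.Ico A (⌊N⌋₊ + 1), 12 * d * (1 / 2 : ℝ) ^ a := by
          refine Finset.sum_le_sum fun a ha => hBle a ?_
          rw [← Nat.le_floor_iff hN0]
          exact Nat.lt_succ_iff.1 (Finset.mem_Ico.1 ha).2
      _ ≤ 12 * d * ((1 / 2 : ℝ) ^ A / (1 - 1 / 2)) := by
          rw [← Finset.mul_sum]
          refine mul_le_mul_of_nonneg_left ?_ (by positivity)
          exact geom_sum_Ico_le_of_lt_one (by norm_num) (by norm_num)
      _ = (1 / 2 : ℝ) ^ A * (24 * d) := by ring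
      _ ≤ ε := ((lt_div_iff₀ (by positivity)).1 hA).le
  set E : Set (SimpleGraph (Fin n)) := {G : SimpleGraph (Fin n) |
    ∀ t : ℝ, t₀ n ≤ t → t ≤ N →
      ∀ Δ : Set (Fin n), ENNReal.ofReal (2 * t) < (G.distToSet v Δ : ENNReal) →
        ∃ S : Set (SimpleGraph.SAW G v),
          G.IsPermissiveCutset (fun _ => (Finset.univ : Finset (Fin (K + 1)))) v Δ S ∧
          ∀ x ∈ S,
            t ≤ ((G.sawTree v).dist (SimpleGraph.SAW.root G v) x : ℝ) ∧
            ((G.sawTree v).dist (SimpleGraph.SAW.root G v) x : ℝ) < 2 * t} with hE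
  -- Subadditivity over this cover gives `1 ≤ P(E) + ε`.
  have hcover : (Set.univ : Set (SimpleGraph (Fin n))) ⊆
      E ∪ ⋃ a ∈ Finset.Ico A (⌊N⌋₊ + 1), B a := by
    intro G _
    by_contra hG
    rw [Set.mem_union, not_or] at hG
    refine hG.1 fun t ht htN Δ hΔ => ?_
    have htA : A + 2 ≤ ⌈t⌉₊ := by
      have : ((A + 2 : ℕ) : ℝ) ≤ ⌈t⌉₊ := by
        push_cast
        exact (hn.trans ht).trans (Nat.le_ceil t)
      exact_mod_cast this
    obtain ⟨a, ha⟩ : ∃ a, ⌈t⌉₊ = a + 2 := ⟨⌈t⌉₊ - 2, by omega⟩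
    have haN : a ≤ ⌊N⌋₊ := by
      refine Nat.le_floor (le_trans ?_ htN)
      have h1 := Nat.ceil_lt_add_one (a := t) (by
        have : (0 : ℝ) ≤ A := Nat.cast_nonneg _
        linarith)
      rw [ha] at h1
      push_cast at h1
      linarith
    refine SimpleGraph.exists_isPermissiveCutset _ Δ ha hΔ fun f hf0 hf hadj => ?_
    by_contra! hperm
    refine hG.2 (Set.mem_biUnion (x := a) (Finset.mem_coe.2 (Finset.mem_Ico.2 ⟨?_, ?_⟩))
      ⟨f, hf0, hf, hadj, fun i hi => ?_⟩)
    · omega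
    · omega
    · have h := hperm i hi
      unfold SimpleGraph.IsPermissive at h
      push Not at h
      obtain ⟨u, hu, h⟩ := h
      refine ⟨u, hu, ?_⟩
      rw [Finset.card_univ, Fintype.card_fin] at h
      exact Nat.le_of_succ_le_succ h
  have h1 := (MeasureTheory.measureReal_mono hcover).trans
    (MeasureTheory.measureReal_union_le (μ := SimpleGraph.binomialRandom (Fin n) p) E _)
  rw [MeasureTheory.probReal_univ] at h1
  linarith
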